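/- **Setting.** Fix $N\ge 2$ arms. Let $\mathcal H_A$ have orthonormal basis $|1\rangle,\dots,|N\rangle$ and let $\mathcal H_R$ be a qubit. For $X\in\{0,1\}^N$ let $O_X|i\rangle|c\rangle=|i\rangle|c\oplus X^i\rangle$ on $\mathcal H_A\otimes\mathcal H_R$. For $\mathbf q\in[0,1]^N$ the one-time channel oracle with mean rewards $\mathbf q$ is $$\mathcal E^{\mathbf q}(\rho)=\sum_{X\in\{0,1\}^N}\Big(\prod_{i=1}^N q_i^{X^i}(1-q_i)^{1-X^i}\Big)\,O_X\,\rho\,O_X^\dagger .$$ A quantum algorithm with $T$ oracle calls consists of a finite-dimensional work space $\mathcal H_W$, an initial density matrix $\rho_0$ on $\mathcal H_A\otimes\mathcal H_R\otimes\mathcal H_W$, unitaries $U_1,\dots,U_T$ on this space, and a POVM $(M_i)_{1\le i\le N}$. With oracle $\mathcal E^{\mathbf q}$ it produces $\rho_t=(\mathcal E^{\mathbf q}\otimes\mathrm{Id})(U_t\rho_{t-1}U_t^\dagger)$, $1\le t\le T$, and returns arm $i$ with probability $\operatorname{tr}(M_i\rho_T)$. For a vector $\mathbf q$ with a unique best arm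 $b$ (that is, $q_i<q_b$ for all $i\ne b$) let $H(\mathbf q)=\sum_{i\neq b}(q_b-q_i)^{-2}$. Let $0<\eta$ and let $p_0,\dots,p_N\in[\eta,1-\eta]$ satisfy $p_0>p_1>p_2\ge\dots\ge p_N$ and $p_0-p_1=p_1-p_2$. Put $\Delta_i=p_0-p_i$. Let $\mathbf p^0=(p_1,\dots,p_N)$ and, for $1\le k\le N$, let $\mathbf p^k$ be the vector obtained from $\mathbf p^0$ by replacing its $k$-th entry with $p_0$. (The best arm of $\mathbf p^0$ is $1$, and the best arm of $\mathbf p^k$ is $k$ for $k\ge1$.) **Theorem.** Let $0\le\delta<1/2$ and $\eta>0$. 1. There is a constant $c=c(\delta,\eta)>0$, depending only on $\delta$ and $\eta$, such that for all $N\ge2$ and all $p_0,\dots,p_N$ as above, every quantum algorithm that, for each $k\in\{0,\dots,N\}$, returns the best arm of $\mathbf p^k$ with probability at least $1-\delta$ when it is run with the oracle $\mathcal E^{\mathbf p^k}$, makes at least $$T\ \ge\ c\,H(\mathbf p^1)\ =\ c\sum_{i=2}^N\Delta_i^{-2}$$ oracle calls. 2. If in addition $\Delta_N^2/\eta\le 1/2$,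 then this bound holds with $$c=\left(\frac{\eta\,\big(1-2\sqrt{\delta(1-\delta)}\big)}{20}\right)^2 .$$ -/

import Mathlib

open scoped Kronecker ComplexOrder

noncomputable section

/-- `X i` is the reward bit of arm `i`.  The unitary `O_X` on `H_A ⊗ H_R` (arm register with basis
`Fin N`, reward qubit with basis `Bool`) that maps `|i⟩|c⟩` to `|i⟩|c + X i⟩`. -/
def oracleUnitary {N : ℕ} (X : Fin N → Bool) : Matrix (Fin N × Bool) (Fin N × Bool) ℂ :=
  Matrix.of fun a b => if a = (b.1, xor b.2 (X b.1)) then 1 else 0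

/-- The probability of the reward bits `X` when the bit of arm `i` is `Ber(q i)` distributed and
the bits of different arms are independent. -/
def rewardProb {N : ℕ} (q : Fin N → ℝ) (X : Fin N → Bool) : ℝ :=
  ∏ i, if X i then q i else 1 - q i

/-- The one-time channel oracle with mean rewards `q`, tensored with the identity on a work space
with basis `W`: `ρ ↦ ∑_X ℙ(X) (O_X ⊗ 1) ρ (O_X ⊗ 1)†`. -/
def oracleChannel {N : ℕ} {W : Type} [Fintype W] [DecidableEq W] (q : Fin N → ℝ)
    (ρ : Matrix ((Fin N × Bool) × W) ((Fin N × Bool) × W) ℂ) :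
    Matrix ((Fin N × Bool) × W) ((Fin N × Bool) × W) ℂ :=
  ∑ X : Fin N → Bool, (rewardProb q X : ℂ) •
    ((oracleUnitary X ⊗ₖ (1 : Matrix W W ℂ)) * ρ * (oracleUnitary X ⊗ₖ (1 : Matrix W W ℂ)).conjTranspose)

/-- A quantum algorithm for `N` arms with work space `W`: an initial density matrix, a unitary
that is applied before each oracle call, and a final POVM measurement whose outcome is the arm
that the algorithm returns.  Only the gates `gate 0, …, gate (queries - 1)` are used. -/
structure QuantumAlgorithm (N : ℕ) (W : Type) [Fintype W] [DecidableEq W] where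
  /-- the number of oracle calls -/
  queries : ℕ
  /-- the initial state -/
  init : Matrix ((Fin N × Bool) × W) ((Fin N × Bool) × W) ℂ
  init_posSemidef : init.PosSemidef
  init_trace : init.trace = 1
  /-- the unitaries between the oracle calls -/
  gate : ℕ → Matrix.unitaryGroup ((Fin N × Bool) × W) ℂ
  /-- the final measurement -/
  povm : Fin N → Matrix ((Fin N × Bool) × W) ((Fin N × Bool) × W) ℂ
  povm_posSemidef : ∀ i, (povm i).PosSemidef
  povm_sum : ∑ i, povm i = 1

namespace QuantumAlgorithm

variable {N : ℕ} {W : Type} [Fintype W] [DecidableEq W]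

/-- The state after `t` oracle calls, when the oracle has mean rewards `q`. -/
def state (A : QuantumAlgorithm N W) (q : Fin N → ℝ) :
    ℕ → Matrix ((Fin N × Bool) × W) ((Fin N × Bool) × W) ℂ
  | 0 => A.init
  | t + 1 => oracleChannel q ((A.gate t).1 * state A q t * (A.gate t).1.conjTranspose)

/-- The probability that the algorithm returns arm `i`, when the oracle has mean rewards `q`. -/
def outputProb (A : QuantumAlgorithm N W) (q : Fin N → ℝ) (i : Fin N) : ℝ :=
  (A.povm i * A.state q A.queries).trace.re

end QuantumAlgorithm

/-- Arm `i` is the (unique) best arm for the mean rewards `q`. -/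
def IsBestArm {N : ℕ} (q : Fin N → ℝ) (i : Fin N) : Prop :=
  ∀ j, j ≠ i → q j < q i

/-- With mean rewards `q`, the algorithm returns the best arm with probability at least `1 - δ`. -/
def QuantumAlgorithm.IdentifiesBestArm {N : ℕ} {W : Type} [Fintype W] [DecidableEq W]
    (A : QuantumAlgorithm N W) (δ : ℝ) (q : Fin N → ℝ) : Prop :=
  ∃ i, IsBestArm q i ∧ 1 - δ ≤ A.outputProb q i

/-- The quantity `H(q)`: the sum of the inverse squared gaps over all arms but the best one
(for mean rewards with a unique best arm). -/
def hardness {N : ℕ} (q : Fin N → ℝ) : ℝ :=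
  ∑ i with q i < ⨆ j, q j, 1 / ((⨆ j, q j) - q i) ^ 2

/-- The assumptions on the numbers `p 0, p 1, …, p N` (later terms of the sequence play no role):
`p 0 > p 1 > p 2 ≥ … ≥ p N`, `p 0 - p 1 = p 1 - p 2`, and all of them lie in `[η, 1 - η]`. -/
structure IsRewardSequence (N : ℕ) (η : ℝ) (p : ℕ → ℝ) : Prop where
  two_le : 2 ≤ N
  one_lt_zero : p 1 < p 0
  two_lt_one : p 2 < p 1
  antitone : ∀ j, 2 ≤ j → j < N → p (j + 1) ≤ p j
  spacing : p 0 - p 1 = p 1 - p 2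
  mem_Icc : ∀ j, j ≤ N → p j ∈ Set.Icc η (1 - η)

/-- The reward vector `𝐩^k`, `0 ≤ k ≤ N`.  The arms `1, …, N` are represented by `Fin N`, the
arm `j : Fin N` having number `j + 1`; arm number `i` has mean reward `p i` if `i ≠ k`, and
`p 0` if `i = k`. -/
def rewardVector {N : ℕ} (p : ℕ → ℝ) (k : ℕ) : Fin N → ℝ :=
  fun j => if (j : ℕ) + 1 = k then p 0 else p (j + 1)

end

set_option linter.unusedSectionVars false

open Matrix

section Purification

open scoped MatrixOrder Matrix.Norms.L2Operator in
theorem Matrix.PosSemidef.exists_eq_conjTranspose_mul_self {n : Type} [Fintype n]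
    {M : Matrix n n ℂ} (h : M.PosSemidef) : ∃ C : Matrix n n ℂ, M = Cᴴ * C := by
  classical
  exact CStarAlgebra.nonneg_iff_eq_star_mul_self.mp h.nonneg

variable {n ι : Type} [Fintype n] [Fintype ι]

/-- `ρ` and `σ` have purifications over a common environment with cross term `R`. -/
def HasCommonPurification (ρ σ R : Matrix n n ℂ) : Prop :=
  ∃ (E : Type) (_ : Fintype E) (A B : Matrix n E ℂ), ρ = A * Aᴴ ∧ σ = B * Bᴴ ∧ R = B * Aᴴ

theorem Matrix.PosSemidef.hasCommonPurification {ρ : Matrix n n ℂ} (h : ρ.PosSemidef) :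
    HasCommonPurification ρ ρ ρ := by
  obtain ⟨C, rfl⟩ := h.exists_eq_conjTranspose_mul_self
  exact ⟨n, inferInstance, Cᴴ, Cᴴ, by simp, by simp, by simp⟩

theorem HasCommonPurification.sum_conj {ρ σ R : Matrix n n ℂ} (h : HasCommonPurification ρ σ R)
    (K L : ι → Matrix n n ℂ) :
    HasCommonPurification (∑ a, K a * ρ * (K a)ᴴ) (∑ a, L a * σ * (L a)ᴴ)
      (∑ a, L a * R * (K a)ᴴ) := by
  obtain ⟨E, _, A, B, rfl, rfl, rfl⟩ := h
  have key : ∀ (K L : ι → Matrix n n ℂ) (A B : Matrix n E ℂ),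
      ∑ a, L a * (B * Aᴴ) * (K a)ᴴ = (Matrix.of fun x (e : ι × E) => (L e.1 * B) x e.2) *
        (Matrix.of fun x (e : ι × E) => (K e.1 * A) x e.2)ᴴ := by
    intro K L A B
    ext x y
    rw [Matrix.sum_apply, Matrix.mul_apply, Fintype.sum_prod_type]
    refine Finset.sum_congr rfl fun a _ => ?_
    rw [show L a * (B * Aᴴ) * (K a)ᴴ = (L a * B) * (K a * A)ᴴ by
      rw [conjTranspose_mul]; simp only [Matrix.mul_assoc], Matrix.mul_apply]
    rfl
  exact ⟨ι × E, inferInstance, _, _, key K K A A, key L L B B, key K L A B⟩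

theorem HasCommonPurification.conj {ρ σ R : Matrix n n ℂ} (h : HasCommonPurification ρ σ R)
    (U : Matrix n n ℂ) :
    HasCommonPurification (U * ρ * Uᴴ) (U * σ * Uᴴ) (U * R * Uᴴ) := by
  simpa using h.sum_conj (fun _ : Unit => U) (fun _ => U)

theorem HasCommonPurification.posSemidef_left {ρ σ R : Matrix n n ℂ}
    (h : HasCommonPurification ρ σ R) : ρ.PosSemidef := by
  obtain ⟨E, _, A, B, rfl, rfl, rfl⟩ := h
  exact Matrix.posSemidef_self_mul_conjTranspose A

theorem HasCommonPurification.posSemidef_right {ρ σ R : Matrix n n ℂ}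
    (h : HasCommonPurification ρ σ R) : σ.PosSemidef := by
  obtain ⟨E, _, A, B, rfl, rfl, rfl⟩ := h
  exact Matrix.posSemidef_self_mul_conjTranspose B

theorem HasCommonPurification.norm_trace_mul_le {ρ σ R M : Matrix n n ℂ}
    (h : HasCommonPurification ρ σ R) (hM : M.PosSemidef) :
    ‖(M * R).trace‖ ≤ √(M * ρ).trace.re * √(M * σ).trace.re := by
  obtain ⟨E, _, A, B, rfl, rfl, rfl⟩ := h
  obtain ⟨C, rfl⟩ := hM.exists_eq_conjTranspose_mul_self
  have key : ∀ A B : Matrix n E ℂ, (Cᴴ * C * (B * Aᴴ)).trace =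
      ∑ z : n × E, (C * B) z.1 z.2 * star ((C * A) z.1 z.2) := by
    intro A B
    rw [Matrix.mul_assoc, Matrix.trace_mul_comm, show C * (B * Aᴴ) * Cᴴ = (C * B) * (C * A)ᴴ by
      rw [conjTranspose_mul]; simp only [Matrix.mul_assoc], Fintype.sum_prod_type]
    rfl
  have sq : ∀ A : Matrix n E ℂ, (Cᴴ * C * (A * Aᴴ)).trace.re =
      ∑ z : n × E, ‖(C * A) z.1 z.2‖ ^ 2 := by
    intro A
    rw [key, Complex.re_sum]
    refine Finset.sum_congr rfl fun z _ => ?_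
    rw [Complex.star_def, Complex.mul_conj, Complex.ofReal_re, Complex.normSq_eq_norm_sq]
  rw [sq, sq, key, mul_comm]
  refine (norm_sum_le _ _).trans ?_
  simp only [norm_mul, norm_star]
  exact Real.sum_mul_le_sqrt_mul_sqrt _ _ _

theorem Matrix.PosSemidef.re_trace_mul_nonneg {M ρ : Matrix n n ℂ} (hM : M.PosSemidef)
    (hρ : ρ.PosSemidef) : 0 ≤ (M * ρ).trace.re := by
  obtain ⟨C, rfl⟩ := hM.exists_eq_conjTranspose_mul_self
  rw [Matrix.mul_assoc, Matrix.trace_mul_comm]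
  exact (Complex.le_def.mp (hρ.mul_mul_conjTranspose_same C).trace_nonneg).1

end Purification

section Evolution

variable {n ι : Type} [Fintype n] [DecidableEq n] [Fintype ι]

/-- Iterate `X ↦ ∑ a, K a * (U t * X * (U t)ᴴ) * (L a)ᴴ`, starting from `X₀`. -/
def evolve (U : ℕ → Matrix n n ℂ) (K L : ι → Matrix n n ℂ) (X₀ : Matrix n n ℂ) :
    ℕ → Matrix n n ℂ
  | 0 => X₀
  | t + 1 => ∑ a, K a * (U t * evolve U K L X₀ t * (U t)ᴴ) * (L a)ᴴ

theorem evolve_hasCommonPurification (U : ℕ → Matrix n n ℂ) (K L : ι → Matrix n n ℂ)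
    {X₀ : Matrix n n ℂ} (h : X₀.PosSemidef) (t : ℕ) :
    HasCommonPurification (evolve U K K X₀ t) (evolve U L L X₀ t) (evolve U L K X₀ t) := by
  induction t with
  | zero => exact h.hasCommonPurification
  | succ t ih => exact (ih.conj (U t)).sum_conj K L

theorem trace_conj_of_unitary {U : Matrix n n ℂ} (hU : Uᴴ * U = 1) (X : Matrix n n ℂ) :
    (U * X * Uᴴ).trace = X.trace := by
  rw [Matrix.trace_mul_comm, ← Matrix.mul_assoc, hU, Matrix.one_mul]

theorem trace_evolve {U : ℕ → Matrix n n ℂ} (hU : ∀ t, (U t)ᴴ * U t = 1)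
    {K L : ι → Matrix n n ℂ} {P : Matrix n n ℂ} {c : ℝ}
    (hKL : ∑ a, (L a)ᴴ * K a = 1 - (c : ℂ) • P) (X₀ : Matrix n n ℂ) (T : ℕ) :
    (evolve U K L X₀ T).trace = X₀.trace -
      (c : ℂ) * ∑ t ∈ Finset.range T, (P * (U t * evolve U K L X₀ t * (U t)ᴴ)).trace := by
  induction T with
  | zero => simp [evolve]
  | succ T ih =>
    have : (evolve U K L X₀ (T + 1)).trace =
        ((∑ a, (L a)ᴴ * K a) * (U T * evolve U K L X₀ T * (U T)ᴴ)).trace := by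
      rw [evolve, Matrix.trace_sum, Matrix.sum_mul, Matrix.trace_sum]
      refine Finset.sum_congr rfl fun a _ => ?_
      rw [Matrix.trace_mul_comm, ← Matrix.mul_assoc]
    rw [this, hKL, Matrix.sub_mul, Matrix.trace_sub, Matrix.one_mul, trace_conj_of_unitary (hU T),
      ih, Finset.sum_range_succ, Matrix.smul_mul, Matrix.trace_smul, smul_eq_mul]
    ring

/-- If the Kraus operators `L` lose the weight `κ` on the part `P` of the space, and the cross
term of `K` and `L` loses the weight `ε` there, then a big loss of the overlap forces a big total
weight of the states `evolve U K K X₀ t` on `P`. -/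
theorem sq_mul_le_of_overlap_loss {U : ℕ → Matrix n n ℂ} (hU : ∀ t, (U t)ᴴ * U t = 1)
    {K L : ι → Matrix n n ℂ} {P X₀ : Matrix n n ℂ} (hP : P.PosSemidef) (hX₀ : X₀.PosSemidef)
    (htr : X₀.trace = 1) {ε κ γ : ℝ} (hε : 0 ≤ ε) (hκ : 0 ≤ κ) (hγ : 0 ≤ γ)
    (hKL : ∑ a, (K a)ᴴ * L a = 1 - (ε : ℂ) • P) (hLL : ∑ a, (L a)ᴴ * L a = 1 - (κ : ℂ) • P)
    {T : ℕ} (hT : (evolve U L K X₀ T).trace.re ≤ 1 - γ) :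
    γ ^ 2 * κ ≤ ε ^ 2 *
      ∑ t ∈ Finset.range T, (P * (U t * evolve U K K X₀ t * (U t)ᴴ)).trace.re := by
  have hcp t := (evolve_hasCommonPurification U K L hX₀ t).conj (U t)
  set v := fun t => (P * (U t * evolve U K K X₀ t * (U t)ᴴ)).trace.re
  set w := fun t => (P * (U t * evolve U L L X₀ t * (U t)ᴴ)).trace.re
  have hv t : 0 ≤ v t := hP.re_trace_mul_nonneg (hcp t).posSemidef_left
  have hw t : 0 ≤ w t := hP.re_trace_mul_nonneg (hcp t).posSemidef_right
  have hw_sum : κ * ∑ t ∈ Finset.range T, w t ≤ 1 := by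
    have h1 := congrArg Complex.re (trace_evolve hU hLL X₀ T)
    have h2 : 0 ≤ (evolve U L L X₀ T).trace.re :=
      (Complex.le_def.mp
        (evolve_hasCommonPurification U K L hX₀ T).posSemidef_right.trace_nonneg).1
    rw [Complex.sub_re, Complex.re_ofReal_mul, Complex.re_sum, htr, Complex.one_re] at h1
    linarith
  have hloss : γ ≤ ε * ∑ t ∈ Finset.range T, √(v t) * √(w t) := by
    have h1 := congrArg Complex.re (trace_evolve hU hKL X₀ T)
    rw [Complex.sub_re, Complex.re_ofReal_mul, Complex.re_sum, htr, Complex.one_re] at h1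
    have h2 : ∑ t ∈ Finset.range T, (P * (U t * evolve U L K X₀ t * (U t)ᴴ)).trace.re ≤
        ∑ t ∈ Finset.range T, √(v t) * √(w t) :=
      Finset.sum_le_sum fun t _ => (Complex.re_le_norm _).trans ((hcp t).norm_trace_mul_le hP)
    have := mul_le_mul_of_nonneg_left h2 hε
    linarith
  have hCS : (∑ t ∈ Finset.range T, √(v t) * √(w t)) ^ 2 ≤
      (∑ t ∈ Finset.range T, v t) * ∑ t ∈ Finset.range T, w t := by
    refine (Finset.sum_mul_sq_le_sq_mul_sq _ _ _).trans_eq ?_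
    simp only [Real.sq_sqrt, hv, hw]
  have hv_sum : 0 ≤ ∑ t ∈ Finset.range T, v t := Finset.sum_nonneg fun t _ => hv t
  calc γ ^ 2 * κ ≤ (ε * ∑ t ∈ Finset.range T, √(v t) * √(w t)) ^ 2 * κ := by gcongr
    _ = ε ^ 2 * (∑ t ∈ Finset.range T, √(v t) * √(w t)) ^ 2 * κ := by ring
    _ ≤ ε ^ 2 * ((∑ t ∈ Finset.range T, v t) * ∑ t ∈ Finset.range T, w t) * κ := by gcongr
    _ = ε ^ 2 * (∑ t ∈ Finset.range T, v t) * (κ * ∑ t ∈ Finset.range T, w t) := by ring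
    _ ≤ ε ^ 2 * (∑ t ∈ Finset.range T, v t) * 1 := by gcongr
    _ = _ := mul_one _

/-- Damping some of the Kraus operators makes the state smaller. -/
theorem evolve_sub_evolve_posSemidef (U : ℕ → Matrix n n ℂ) (K : ι → Matrix n n ℂ)
    {c : ι → ℝ} (hc : ∀ a, c a ^ 2 ≤ 1) {X₀ : Matrix n n ℂ} (h : X₀.PosSemidef) (t : ℕ) :
    (evolve U K K X₀ t - evolve U (fun a => (c a : ℂ) • K a) (fun a => (c a : ℂ) • K a)
      X₀ t).PosSemidef := by
  induction t with
  | zero => simpa [evolve] using Matrix.PosSemidef.zero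
  | succ t ih =>
    set L : ι → Matrix n n ℂ := fun a => (c a : ℂ) • K a with hL
    have hσ := (evolve_hasCommonPurification U L L h t).posSemidef_left
    rw [evolve, evolve, ← Finset.sum_sub_distrib]
    refine Matrix.posSemidef_sum _ fun a _ => ?_
    have : K a * (U t * evolve U K K X₀ t * (U t)ᴴ) * (K a)ᴴ -
        L a * (U t * evolve U L L X₀ t * (U t)ᴴ) * (L a)ᴴ =
        K a * (U t * (evolve U K K X₀ t - evolve U L L X₀ t) * (U t)ᴴ) * (K a)ᴴ +
        ((1 - c a ^ 2 : ℝ) : ℂ) • (K a * (U t * evolve U L L X₀ t * (U t)ᴴ) * (K a)ᴴ) := by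
      simp only [hL, conjTranspose_smul, Matrix.smul_mul, Matrix.mul_smul, smul_smul,
        Matrix.mul_sub, Matrix.sub_mul, Complex.star_def, Complex.conj_ofReal]
      push_cast
      module
    rw [this]
    refine ((ih.mul_mul_conjTranspose_same _).mul_mul_conjTranspose_same _).add
      (((hσ.mul_mul_conjTranspose_same _).mul_mul_conjTranspose_same _).smul ?_)
    exact_mod_cast sub_nonneg.mpr (hc a)

end Evolution

/-- The overlap of two binary distributions of which one is concentrated on the first outcome
and the other one on the second outcome. -/
theorem sqrt_mul_add_sqrt_mul_le {a b δ : ℝ} (ha : 1 - δ ≤ a) (ha1 : a ≤ 1) (hb : b ≤ δ)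
    (hb0 : 0 ≤ b) (hδ₀ : 0 ≤ δ) (hδ : δ ≤ 1 / 2) :
    √a * √b + √(1 - a) * √(1 - b) ≤ 2 * √(δ * (1 - δ)) := by
  rw [Real.sqrt_mul hδ₀]
  have h1 : √(1 - δ) ≤ √a := Real.sqrt_le_sqrt ha
  have h2 : √(1 - δ) ≤ √(1 - b) := Real.sqrt_le_sqrt (by linarith)
  have h3 : √(1 - a) ≤ √δ := Real.sqrt_le_sqrt (by linarith)
  have h4 : √b ≤ √δ := Real.sqrt_le_sqrt hb
  have sa := Real.sq_sqrt (show 0 ≤ a by linarith)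
  have sa' := Real.sq_sqrt (show 0 ≤ 1 - a by linarith)
  have sb := Real.sq_sqrt hb0
  have sb' := Real.sq_sqrt (show 0 ≤ 1 - b by linarith)
  have sd := Real.sq_sqrt hδ₀
  have sd' := Real.sq_sqrt (show 0 ≤ 1 - δ by linarith)
  have h5 : √(1 - δ) * √(1 - δ) ≤ √a * √(1 - b) := by gcongr
  have h6 : √(1 - a) * √b ≤ √δ * √δ := by gcongr
  have h7 : (1 - 2 * δ) ^ 2 ≤ (√a * √(1 - b) - √(1 - a) * √b) ^ 2 := by
    refine pow_le_pow_left₀ (by linarith) ?_ 2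
    nlinarith
  refine abs_le_of_sq_le_sq' ?_ (by positivity) |>.2
  have e1 : (√a * √b + √(1 - a) * √(1 - b)) ^ 2 +
      (√a * √(1 - b) - √(1 - a) * √b) ^ 2 = 1 := by
    calc _ = (√a ^ 2 + √(1 - a) ^ 2) * (√b ^ 2 + √(1 - b) ^ 2) := by ring
      _ = 1 := by rw [sa, sa', sb, sb']; ring
  have e2 : (2 * (√δ * √(1 - δ))) ^ 2 + (1 - 2 * δ) ^ 2 = 1 := by
    calc _ = 4 * (√δ ^ 2 * √(1 - δ) ^ 2) + (1 - 2 * δ) ^ 2 := by ring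
      _ = 1 := by rw [sd, sd']; ring
  linarith

section ArmKraus

variable {n ι : Type} [Fintype n] [DecidableEq n] [Fintype ι] [DecidableEq ι]

/-- Kraus operators on a space with orthogonal projections `P i`: the contraction
`1 - 2 ∑ i, q i • P i`, and the multiples `c i • P i` of the projections. -/
noncomputable def armKraus (P : ι → Matrix n n ℂ) (q c : ι → ℝ) : Option ι → Matrix n n ℂ
  | none => 1 - ∑ i, (2 * q i : ℂ) • P i
  | some i => (c i : ℂ) • P i

variable {P : ι → Matrix n n ℂ}

theorem armKraus_conjTranspose (hH : ∀ i, (P i)ᴴ = P i) (q c : ι → ℝ) (a : Option ι) :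
    (armKraus P q c a)ᴴ = armKraus P q c a := by
  cases a <;> simp [armKraus, conjTranspose_sum, hH, Complex.conj_ofReal]

theorem sum_smul_mul_sum_smul (hP : ∀ i j, P i * P j = if i = j then P i else 0)
    (a b : ι → ℂ) : (∑ i, a i • P i) * (∑ i, b i • P i) = ∑ i, (a i * b i) • P i := by
  simp [Finset.sum_mul, Finset.mul_sum, hP, smul_smul, mul_comm]

theorem sum_armKraus_conjTranspose_mul (hP : ∀ i j, P i * P j = if i = j then P i else 0)
    (hH : ∀ i, (P i)ᴴ = P i) (q c q' c' : ι → ℝ) :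
    ∑ a, (armKraus P q c a)ᴴ * armKraus P q' c' a =
      1 - ∑ i, ((2 * q i + 2 * q' i - 4 * q i * q' i - c i * c' i : ℝ) : ℂ) • P i := by
  simp only [armKraus_conjTranspose hH]
  simp only [Fintype.sum_option, armKraus, Matrix.sub_mul, Matrix.mul_sub, Matrix.one_mul,
    Matrix.mul_one, sum_smul_mul_sum_smul hP, Matrix.smul_mul, Matrix.mul_smul, hP, if_true,
    smul_smul]
  rw [sub_sub, sub_add, sub_right_inj, ← Finset.sum_sub_distrib, ← Finset.sum_add_distrib,
    ← Finset.sum_sub_distrib]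
  refine Finset.sum_congr rfl fun i _ => ?_
  push_cast
  module

end ArmKraus

section Moments

variable {N : ℕ}

theorem sum_rewardProb_mul_prod (q : Fin N → ℝ) (f : Fin N → Bool → ℝ) :
    ∑ X, rewardProb q X * ∏ i, f i (X i) = ∏ i, (q i * f i true + (1 - q i) * f i false) := by
  have := Finset.prod_univ_sum (fun _ : Fin N => (Finset.univ : Finset Bool))
    (fun i b => (if b then q i else 1 - q i) * f i b)
  rw [Fintype.piFinset_univ] at this
  simp only [Fintype.sum_bool, if_true, Bool.false_eq_true, if_false] at this
  rw [this]
  simp only [rewardProb, Finset.prod_mul_distrib]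

theorem sum_rewardProb (q : Fin N → ℝ) : ∑ X, rewardProb q X = 1 := by
  simpa using sum_rewardProb_mul_prod q fun _ _ => 1

/-- The centred reward bit of arm `i`. -/
def centredBit (q : Fin N → ℝ) (X : Fin N → Bool) (i : Fin N) : ℝ :=
  (if X i then 1 else 0) - q i

theorem sum_rewardProb_mul_centredBit (q : Fin N → ℝ) (i : Fin N) :
    ∑ X, rewardProb q X * centredBit q X i = 0 := by
  have := sum_rewardProb_mul_prod q fun l b => if l = i then (if b then 1 else 0) - q i else 1
  simp only [Finset.prod_ite_eq', Finset.mem_univ, if_true] at this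
  rw [show (∑ X, rewardProb q X * centredBit q X i) = _ from this]
  exact Finset.prod_eq_zero (Finset.mem_univ i) (by simp; ring)

theorem sum_rewardProb_mul_centredBit_mul_centredBit (q : Fin N → ℝ) (i j : Fin N) :
    ∑ X, rewardProb q X * (centredBit q X i * centredBit q X j) =
      if i = j then q i * (1 - q i) else 0 := by
  have := sum_rewardProb_mul_prod q fun l b =>
    (if l = i then (if b then 1 else 0) - q i else 1) *
      (if l = j then (if b then 1 else 0) - q j else 1)
  simp only [Finset.prod_mul_distrib, Finset.prod_ite_eq', Finset.mem_univ, if_true] at this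
  rw [show (∑ X, rewardProb q X * (centredBit q X i * centredBit q X j)) = _ from this]
  by_cases h : i = j
  · subst h
    rw [if_pos rfl, Fintype.prod_eq_single i]
    · simp; ring
    · intro l hl
      simp [hl]
  · rw [if_neg h]
    exact Finset.prod_eq_zero (Finset.mem_univ i) (by simp [h]; ring)

end Moments

section Oracle

variable {N : ℕ} {W : Type} [Fintype W] [DecidableEq W]

/-- The projection onto the span of the vectors `|i⟩|-⟩|w⟩`. -/
noncomputable def minusProj (W : Type) [DecidableEq W] (i : Fin N) :
    Matrix ((Fin N × Bool) × W) ((Fin N × Bool) × W) ℂ :=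
  (Matrix.single i i 1 ⊗ₖ Matrix.of fun c d : Bool => if c = d then 1 / 2 else -1 / 2) ⊗ₖ 1

theorem minusProj_mul (i j : Fin N) :
    minusProj W i * minusProj W j = if i = j then minusProj W i else 0 := by
  have h : ((Matrix.of fun c d : Bool => if c = d then 1 / 2 else -1 / 2) *
      Matrix.of fun c d : Bool => if c = d then 1 / 2 else -1 / 2 : Matrix Bool Bool ℂ) =
      Matrix.of fun c d : Bool => if c = d then 1 / 2 else -1 / 2 := by
    ext c d
    cases c <;> cases d <;> simp [Matrix.mul_apply] <;> norm_num
  rw [minusProj, minusProj, ← Matrix.mul_kronecker_mul, ← Matrix.mul_kronecker_mul, h,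
    Matrix.one_mul]
  split_ifs with hij
  · subst hij
    simp
  · rw [Matrix.single_mul_single_of_ne _ _ _ _ hij]
    simp

theorem minusProj_conjTranspose (i : Fin N) : (minusProj W i)ᴴ = minusProj W i := by
  rw [minusProj, Matrix.conjTranspose_kronecker, Matrix.conjTranspose_kronecker,
    Matrix.conjTranspose_one, Matrix.conjTranspose_single, star_one]
  congr 2
  ext c d
  cases c <;> cases d <;> simp

theorem minusProj_posSemidef (i : Fin N) : (minusProj W i).PosSemidef := by
  have := Matrix.posSemidef_conjTranspose_mul_self (minusProj W i)
  rwa [minusProj_conjTranspose, minusProj_mul, if_pos rfl] at this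

theorem one_sub_sum_minusProj_posSemidef :
    (1 - ∑ i : Fin N, minusProj W i).PosSemidef := by
  have := Matrix.posSemidef_conjTranspose_mul_self (1 - ∑ i : Fin N, minusProj W i)
  rw [Matrix.conjTranspose_sub, Matrix.conjTranspose_sum, Matrix.conjTranspose_one] at this
  simpa [minusProj_conjTranspose, Matrix.sub_mul, Matrix.mul_sub, Finset.sum_mul,
    Finset.mul_sum, minusProj_mul] using this

theorem oracleUnitary_kronecker_one (X : Fin N → Bool) :
    oracleUnitary X ⊗ₖ (1 : Matrix W W ℂ) =
      1 - ∑ i, (2 * if X i then 1 else 0 : ℂ) • minusProj W i := by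
  ext ⟨⟨a, c⟩, w⟩ ⟨⟨b, d⟩, w'⟩
  simp only [Matrix.sub_apply, Matrix.sum_apply, Matrix.smul_apply, minusProj,
    Matrix.kroneckerMap_apply, Matrix.single_apply, Matrix.of_apply, oracleUnitary,
    Matrix.one_apply, Prod.mk.injEq, smul_eq_mul]
  rw [Finset.sum_eq_single a (by intro i _ hi; simp [hi]) (by simp)]
  by_cases hab : a = b
  · subst hab
    cases hX : X a <;> cases c <;> cases d <;> by_cases hw : w = w' <;> simp [hw] <;>
      norm_num
  · simp [hab]

/-- The Kraus coefficients of the oracle. -/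
noncomputable def oracleCoeff (q : Fin N → ℝ) (i : Fin N) : ℝ := 2 * √(q i * (1 - q i))

theorem oracleChannel_eq_sum_armKraus {q : Fin N → ℝ} (hq : ∀ i, 0 ≤ q i * (1 - q i))
    (ρ : Matrix ((Fin N × Bool) × W) ((Fin N × Bool) × W) ℂ) :
    oracleChannel q ρ = ∑ a, armKraus (minusProj W) q (oracleCoeff q) a * ρ *
      (armKraus (minusProj W) q (oracleCoeff q) a)ᴴ := by
  set K := armKraus (minusProj W) q (oracleCoeff q) none with hK
  set D : (Fin N → Bool) → Matrix ((Fin N × Bool) × W) ((Fin N × Bool) × W) ℂ :=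
    fun X => ∑ i, (2 * centredBit q X i : ℂ) • minusProj W i with hD
  have hO X : oracleUnitary X ⊗ₖ (1 : Matrix W W ℂ) = K - D X := by
    rw [oracleUnitary_kronecker_one, hK, hD, armKraus, sub_sub, ← Finset.sum_add_distrib]
    congr 1
    refine Finset.sum_congr rfl fun i _ => ?_
    rw [← add_smul]
    congr 1
    simp only [centredBit]
    split_ifs <;> push_cast <;> ring
  have hKH : Kᴴ = K := armKraus_conjTranspose minusProj_conjTranspose _ _ _
  have hDH X : (D X)ᴴ = D X := by
    simp [hD, conjTranspose_sum, minusProj_conjTranspose, Complex.conj_ofReal]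
  have hD0 : ∑ X, (rewardProb q X : ℂ) • D X = 0 := by
    simp only [hD, Finset.smul_sum, smul_smul]
    rw [Finset.sum_comm]
    refine Finset.sum_eq_zero fun i _ => ?_
    rw [← Finset.sum_smul]
    have h := congrArg (fun x : ℝ => (2 * x : ℂ)) (sum_rewardProb_mul_centredBit q i)
    push_cast at h
    rw [mul_zero, Finset.mul_sum] at h
    rw [← zero_smul ℂ (minusProj W i), ← h]
    congr 1
    exact Finset.sum_congr rfl fun X _ => by ring
  have hDD : ∑ X, (rewardProb q X : ℂ) • (D X * ρ * D X) =
      ∑ i, (4 * (q i * (1 - q i)) : ℂ) • (minusProj W i * ρ * minusProj W i) := by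
    simp only [hD, Finset.sum_mul, Finset.mul_sum, Matrix.smul_mul, Matrix.mul_smul,
      Finset.smul_sum, smul_smul]
    rw [Finset.sum_comm]
    refine Finset.sum_congr rfl fun j _ => ?_
    rw [Finset.sum_comm, Finset.sum_eq_single j]
    · rw [← Finset.sum_smul]
      congr 1
      have h := congrArg (fun x : ℝ => (4 * x : ℂ))
        (sum_rewardProb_mul_centredBit_mul_centredBit q j j)
      rw [if_pos rfl] at h
      push_cast at h
      rw [← h, Finset.mul_sum]
      exact Finset.sum_congr rfl fun X _ => by ring
    · intro i _ hij
      rw [← Finset.sum_smul]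
      have h := congrArg (fun x : ℝ => (4 * x : ℂ))
        (sum_rewardProb_mul_centredBit_mul_centredBit q i j)
      rw [if_neg hij] at h
      push_cast at h
      rw [mul_zero, Finset.mul_sum] at h
      rw [← zero_smul ℂ (minusProj W i * ρ * minusProj W j), ← h]
      congr 1
      exact Finset.sum_congr rfl fun X _ => by ring
    · simp
  have hsum : ∑ X, (rewardProb q X : ℂ) = 1 := by exact_mod_cast sum_rewardProb q
  calc oracleChannel q ρ
      = ∑ X, (rewardProb q X : ℂ) • ((K - D X) * ρ * (K - D X)) := by
        rw [oracleChannel]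
        refine Finset.sum_congr rfl fun X _ => ?_
        rw [hO, conjTranspose_sub, hKH, hDH]
    _ = (∑ X, (rewardProb q X : ℂ)) • (K * ρ * K) - K * ρ * ∑ X, (rewardProb q X : ℂ) • D X -
        (∑ X, (rewardProb q X : ℂ) • D X) * ρ * K +
        ∑ X, (rewardProb q X : ℂ) • (D X * ρ * D X) := by
        rw [Finset.sum_smul, Finset.mul_sum, Finset.sum_mul, Finset.sum_mul,
          ← Finset.sum_sub_distrib, ← Finset.sum_sub_distrib, ← Finset.sum_add_distrib]
        refine Finset.sum_congr rfl fun X _ => ?_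
        simp only [Matrix.smul_mul, Matrix.mul_smul, Matrix.sub_mul, Matrix.mul_sub]
        module
    _ = _ := by
        rw [hsum, hD0, hDD, Fintype.sum_option, hKH]
        simp only [one_smul, Matrix.mul_zero, Matrix.zero_mul, sub_zero]
        congr 1
        refine Finset.sum_congr rfl fun i _ => ?_
        rw [armKraus_conjTranspose minusProj_conjTranspose]
        simp only [armKraus, Matrix.smul_mul, Matrix.mul_smul, smul_smul]
        congr 1
        have := Real.mul_self_sqrt (hq i)
        rw [oracleCoeff]
        norm_cast
        linear_combination -4 * this

theorem QuantumAlgorithm.state_eq_evolve (A : QuantumAlgorithm N W) {q : Fin N → ℝ}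
    (hq : ∀ i, 0 ≤ q i * (1 - q i)) (t : ℕ) :
    A.state q t = evolve (fun t => (A.gate t).1) (armKraus (minusProj W) q (oracleCoeff q))
      (armKraus (minusProj W) q (oracleCoeff q)) A.init t := by
  induction t with
  | zero => rfl
  | succ t ih => rw [QuantumAlgorithm.state, evolve, oracleChannel_eq_sum_armKraus hq, ih]

end Oracle

namespace QuantumAlgorithm

variable {N : ℕ} {W : Type} [Fintype W] [DecidableEq W]

theorem gate_conjTranspose_mul (A : QuantumAlgorithm N W) (t : ℕ) :
    (A.gate t).1ᴴ * (A.gate t).1 = 1 :=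
  Matrix.mem_unitaryGroup_iff'.mp (A.gate t).2

theorem posSemidef_state (A : QuantumAlgorithm N W) {q : Fin N → ℝ}
    (hq : ∀ i, 0 ≤ q i * (1 - q i)) (t : ℕ) : (A.state q t).PosSemidef := by
  rw [A.state_eq_evolve hq]
  exact (evolve_hasCommonPurification _ _ (armKraus (minusProj W) q (oracleCoeff q))
    A.init_posSemidef t).posSemidef_left

theorem trace_state (A : QuantumAlgorithm N W) {q : Fin N → ℝ}
    (hq : ∀ i, 0 ≤ q i * (1 - q i)) (t : ℕ) : (A.state q t).trace = 1 := by
  rw [A.state_eq_evolve hq, trace_evolve (c := 0) (P := 0) A.gate_conjTranspose_mul, A.init_trace]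
  · simp
  · rw [sum_armKraus_conjTranspose_mul minusProj_mul minusProj_conjTranspose]
    congr 1
    rw [smul_zero]
    refine Finset.sum_eq_zero fun i _ => ?_
    have := Real.mul_self_sqrt (hq i)
    rw [oracleCoeff, show 2 * q i + 2 * q i - 4 * q i * q i - 2 * √(q i * (1 - q i)) *
      (2 * √(q i * (1 - q i))) = 0 by linear_combination -4 * this]
    simp

/-- The probability of the measurement outcomes other than `i`. -/
theorem re_trace_one_sub_povm_mul_state (A : QuantumAlgorithm N W) {q : Fin N → ℝ}
    (hq : ∀ i, 0 ≤ q i * (1 - q i)) (i : Fin N) :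
    ((1 - A.povm i) * A.state q A.queries).trace.re = 1 - A.outputProb q i := by
  rw [Matrix.sub_mul, Matrix.trace_sub, Matrix.one_mul, A.trace_state hq, Complex.sub_re,
    Complex.one_re, outputProb]

theorem one_sub_povm (A : QuantumAlgorithm N W) (i : Fin N) :
    1 - A.povm i = ∑ j ∈ Finset.univ.erase i, A.povm j := by
  rw [← A.povm_sum, ← Finset.add_sum_erase _ _ (Finset.mem_univ i), add_sub_cancel_left]

theorem one_sub_povm_posSemidef (A : QuantumAlgorithm N W) (i : Fin N) :
    (1 - A.povm i).PosSemidef := by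
  rw [one_sub_povm]
  exact Matrix.posSemidef_sum _ fun j _ => A.povm_posSemidef j

theorem outputProb_nonneg (A : QuantumAlgorithm N W) {q : Fin N → ℝ}
    (hq : ∀ i, 0 ≤ q i * (1 - q i)) (i : Fin N) : 0 ≤ A.outputProb q i :=
  (A.povm_posSemidef i).re_trace_mul_nonneg (A.posSemidef_state hq _)

theorem outputProb_le_one (A : QuantumAlgorithm N W) {q : Fin N → ℝ}
    (hq : ∀ i, 0 ≤ q i * (1 - q i)) (i : Fin N) : A.outputProb q i ≤ 1 := by
  have := (A.one_sub_povm_posSemidef i).re_trace_mul_nonneg (A.posSemidef_state hq A.queries)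
  rw [A.re_trace_one_sub_povm_mul_state hq] at this
  linarith

theorem sum_outputProb (A : QuantumAlgorithm N W) {q : Fin N → ℝ}
    (hq : ∀ i, 0 ≤ q i * (1 - q i)) : ∑ i, A.outputProb q i = 1 := by
  simp only [outputProb]
  rw [← Complex.re_sum, ← Matrix.trace_sum, ← Matrix.sum_mul, A.povm_sum, Matrix.one_mul,
    A.trace_state hq, Complex.one_re]

theorem outputProb_le_of_ne (A : QuantumAlgorithm N W) {q : Fin N → ℝ} {δ : ℝ}
    (hq : ∀ i, 0 ≤ q i * (1 - q i)) {i j : Fin N} (hij : i ≠ j) (h : 1 - δ ≤ A.outputProb q j) :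
    A.outputProb q i ≤ δ := by
  have h1 : A.outputProb q i + A.outputProb q j ≤ 1 := by
    rw [← A.sum_outputProb hq, ← Finset.sum_pair hij]
    exact Finset.sum_le_sum_of_subset_of_nonneg (Finset.subset_univ _)
      fun l _ _ => A.outputProb_nonneg hq l
  linarith

/-- The total weight with which the algorithm queries arm `k`, when the oracle has mean
rewards `q`. -/
noncomputable def armWeight (A : QuantumAlgorithm N W) (q : Fin N → ℝ) (k : Fin N) : ℝ :=
  ∑ t ∈ Finset.range A.queries,
    (minusProj W k * ((A.gate t).1 * A.state q t * (A.gate t).1ᴴ)).trace.re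

theorem armWeight_nonneg (A : QuantumAlgorithm N W) {q : Fin N → ℝ}
    (hq : ∀ i, 0 ≤ q i * (1 - q i)) (k : Fin N) : 0 ≤ A.armWeight q k :=
  Finset.sum_nonneg fun t _ => (minusProj_posSemidef k).re_trace_mul_nonneg
    ((A.posSemidef_state hq t).mul_mul_conjTranspose_same _)

theorem sum_armWeight_le (A : QuantumAlgorithm N W) {q : Fin N → ℝ}
    (hq : ∀ i, 0 ≤ q i * (1 - q i)) : ∑ k, A.armWeight q k ≤ A.queries := by
  simp only [armWeight]
  rw [Finset.sum_comm]
  refine (Finset.sum_le_card_nsmul _ _ 1 fun t _ => ?_).trans_eq (by simp)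
  rw [← Complex.re_sum, ← Matrix.trace_sum, ← Matrix.sum_mul]
  have h := one_sub_sum_minusProj_posSemidef.re_trace_mul_nonneg
    ((A.posSemidef_state hq t).mul_mul_conjTranspose_same (A.gate t).1)
  rw [Matrix.sub_mul, Matrix.trace_sub, Matrix.one_mul,
    trace_conj_of_unitary (A.gate_conjTranspose_mul t), A.trace_state hq, Complex.sub_re,
    Complex.one_re] at h
  linarith

end QuantumAlgorithm

/-- Bounds for the loss of overlap between the environments of two oracles with mean rewards `x`
and `y`, given the square roots `c` and `c'` of the variances of the rewards `±1`. -/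
theorem overlap_loss_bounds {x y c c' η : ℝ} (hη : 0 < η) (hx : x ∈ Set.Icc η (1 - η))
    (hy : y ∈ Set.Icc η (1 - η)) (hc : 0 ≤ c) (hc' : 0 ≤ c') (hcx : c ^ 2 = 4 * (x * (1 - x)))
    (hcy : c' ^ 2 = 4 * (y * (1 - y))) :
    0 ≤ 2 * x + 2 * y - 4 * x * y - c * c' ∧
      2 * x + 2 * y - 4 * x * y - c * c' ≤ (x - y) ^ 2 / η ∧ c * c' ≤ 1 ∧ 2 * η ≤ c' ^ 2 := by
  obtain ⟨hx1, hx2⟩ := hx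
  obtain ⟨hy1, hy2⟩ := hy
  have hη2 : η ≤ 1 / 2 := by linarith
  have hvar : ∀ z, η ≤ z → z ≤ 1 - η → 2 * η ≤ 4 * (z * (1 - z)) := by
    intro z h1 h2
    nlinarith [mul_nonneg (sub_nonneg.mpr h1) (sub_nonneg.mpr h2)]
  have hvx := hvar x hx1 hx2
  have hvy := hvar y hy1 hy2
  have hS : 0 ≤ 2 * x + 2 * y - 4 * x * y := by nlinarith
  have hfac : (2 * x + 2 * y - 4 * x * y) ^ 2 - (c * c') ^ 2 = 4 * (x - y) ^ 2 := by
    rw [mul_pow, hcx, hcy]; ring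
  have hge : c * c' ≤ 2 * x + 2 * y - 4 * x * y := by
    refine abs_le_of_sq_le_sq' ?_ hS |>.2
    nlinarith [sq_nonneg (x - y)]
  have hcc : 2 * η ≤ c * c' := by
    refine abs_le_of_sq_le_sq' ?_ (by positivity) |>.2
    rw [mul_pow c, hcx, hcy, sq]
    exact mul_le_mul hvx hvy (by positivity) (by linarith)
  refine ⟨by linarith, ?_, ?_, by linarith⟩
  · rw [le_div_iff₀ hη]
    nlinarith
  · nlinarith [sq_nonneg (c - c'), sq_nonneg (x - 1 / 2), sq_nonneg (y - 1 / 2)]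

/-- An algorithm that distinguishes two oracles that differ only in the mean reward of arm `k`
has to query this arm. -/
theorem QuantumAlgorithm.armWeight_lower_bound {N : ℕ} {W : Type} [Fintype W] [DecidableEq W]
    (A : QuantumAlgorithm N W) {q q' : Fin N → ℝ} {η δ μ : ℝ} {k i : Fin N} (hη : 0 < η)
    (hδ₀ : 0 ≤ δ) (hδ : δ ≤ 1 / 2) (hμ₀ : 0 ≤ μ) (hμ : μ ≤ 1)
    (hq : ∀ j, q j ∈ Set.Icc η (1 - η)) (hq' : ∀ j, q' j ∈ Set.Icc η (1 - η))
    (hqq' : ∀ j, j ≠ k → q j = q' j) (h : 1 - δ ≤ A.outputProb q i)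
    (h' : A.outputProb q' i ≤ δ) (hγ : 0 ≤ 1 - 2 * √(δ * (1 - δ))) :
    (1 - 2 * √(δ * (1 - δ))) ^ 2 * (2 * η * μ) ≤
      ((q k - q' k) ^ 2 / η + μ) ^ 2 * A.armWeight q k := by
  have hvar : ∀ {q : Fin N → ℝ}, (∀ j, q j ∈ Set.Icc η (1 - η)) → ∀ j, 0 ≤ q j * (1 - q j) :=
    fun hq j => mul_nonneg (hη.le.trans (hq j).1) (by linarith [(hq j).2])
  have hv := hvar hq
  have hv' := hvar hq'
  have hsq : ∀ {q : Fin N → ℝ}, (∀ j, 0 ≤ q j * (1 - q j)) → ∀ j,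
      oracleCoeff q j ^ 2 = 4 * (q j * (1 - q j)) := by
    intro q hq j
    rw [oracleCoeff, mul_pow, Real.sq_sqrt (hq j)]; norm_num
  have hcoeff : ∀ (q : Fin N → ℝ) j, 0 ≤ oracleCoeff q j := fun q j => by
    rw [oracleCoeff]; positivity
  obtain ⟨b1, b2, b3, b4⟩ := overlap_loss_bounds hη (hq k) (hq' k) (hcoeff q k) (hcoeff q' k)
    (hsq hv k) (hsq hv' k)
  set d : Option (Fin N) → ℝ := fun a => if a = some k then 1 - μ else 1 with hd
  set U : ℕ → Matrix ((Fin N × Bool) × W) ((Fin N × Bool) × W) ℂ := fun t => (A.gate t).1 with hU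
  set K := armKraus (minusProj W) q (oracleCoeff q) with hK
  set K' := armKraus (minusProj W) q' (oracleCoeff q') with hK'
  set L : Option (Fin N) → Matrix ((Fin N × Bool) × W) ((Fin N × Bool) × W) ℂ :=
    fun a => (d a : ℂ) • K' a with hL
  have hL_eq : L = armKraus (minusProj W) q' fun j => d (some j) * oracleCoeff q' j := by
    funext a
    cases a with
    | none => simp [hL, hK', hd, armKraus]
    | some j => simp only [hL, hK', armKraus, smul_smul, Complex.ofReal_mul]
  set ε := 2 * q k + 2 * q' k - 4 * q k * q' k - oracleCoeff q k * ((1 - μ) * oracleCoeff q' k)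
    with hε
  set κ := (1 - (1 - μ) ^ 2) * oracleCoeff q' k ^ 2 with hκ
  have hKL : ∑ a, (K a)ᴴ * L a = 1 - (ε : ℂ) • minusProj W k := by
    rw [hL_eq, sum_armKraus_conjTranspose_mul minusProj_mul minusProj_conjTranspose,
      Fintype.sum_eq_single k]
    · simp [hd, hε]
    · intro j hj
      have h1 := hsq hv' j
      have h2 : oracleCoeff q j = oracleCoeff q' j := by rw [oracleCoeff, oracleCoeff, hqq' j hj]
      have h3 : d (some j) = 1 := by simp [hd, hj]
      rw [h2, h3, hqq' j hj, show 2 * q' j + 2 * q' j - 4 * q' j * q' j -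
        oracleCoeff q' j * (1 * oracleCoeff q' j) = 0 by linear_combination -h1]
      simp
  have hLL : ∑ a, (L a)ᴴ * L a = 1 - (κ : ℂ) • minusProj W k := by
    rw [hL_eq, sum_armKraus_conjTranspose_mul minusProj_mul minusProj_conjTranspose,
      Fintype.sum_eq_single k]
    · have h1 := hsq hv' k
      have h3 : d (some k) = 1 - μ := by simp [hd]
      rw [h3, hκ, show 2 * q' k + 2 * q' k - 4 * q' k * q' k -
        (1 - μ) * oracleCoeff q' k * ((1 - μ) * oracleCoeff q' k) =
        (1 - (1 - μ) ^ 2) * oracleCoeff q' k ^ 2 by linear_combination -h1]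
    · intro j hj
      have h1 := hsq hv' j
      have h3 : d (some j) = 1 := by simp [hd, hj]
      rw [h3, show 2 * q' j + 2 * q' j - 4 * q' j * q' j -
        1 * oracleCoeff q' j * (1 * oracleCoeff q' j) = 0 by linear_combination -h1]
      simp
  have hcp := evolve_hasCommonPurification U K L A.init_posSemidef A.queries
  have hdom : (A.state q' A.queries - evolve U L L A.init A.queries).PosSemidef := by
    rw [A.state_eq_evolve hv']
    refine evolve_sub_evolve_posSemidef U K' (fun a => ?_) A.init_posSemidef _
    simp only [hd]
    split_ifs <;> nlinarith
  have hle : ∀ {M : Matrix ((Fin N × Bool) × W) ((Fin N × Bool) × W) ℂ}, M.PosSemidef →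
      ‖(M * evolve U L K A.init A.queries).trace‖ ≤
        √(M * A.state q A.queries).trace.re * √(M * A.state q' A.queries).trace.re := by
    intro M hM
    refine (hcp.norm_trace_mul_le hM).trans ?_
    rw [show A.state q A.queries = evolve U K K A.init A.queries from A.state_eq_evolve hv _]
    have := hM.re_trace_mul_nonneg hdom
    rw [Matrix.mul_sub, Matrix.trace_sub, Complex.sub_re] at this
    exact mul_le_mul_of_nonneg_left (Real.sqrt_le_sqrt (by linarith)) (Real.sqrt_nonneg _)
  have hT : (evolve U L K A.init A.queries).trace.re ≤ 1 - (1 - 2 * √(δ * (1 - δ))) := by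
    have h1 := hle (A.povm_posSemidef i)
    have h2 := hle (A.one_sub_povm_posSemidef i)
    rw [A.re_trace_one_sub_povm_mul_state hv, A.re_trace_one_sub_povm_mul_state hv'] at h2
    have h3 := sqrt_mul_add_sqrt_mul_le h (A.outputProb_le_one hv i) h'
      (A.outputProb_nonneg hv' i) hδ₀ hδ
    have h4 : (evolve U L K A.init A.queries).trace =
        (A.povm i * evolve U L K A.init A.queries).trace +
        ((1 - A.povm i) * evolve U L K A.init A.queries).trace := by
      rw [← Matrix.trace_add, ← Matrix.add_mul, add_sub_cancel, Matrix.one_mul]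
    have h5 := (Complex.re_le_norm _).trans h1
    have h6 := (Complex.re_le_norm _).trans h2
    rw [h4, Complex.add_re]
    simp only [QuantumAlgorithm.outputProb] at h3 h6
    linarith
  have hε_eq : ε = (2 * q k + 2 * q' k - 4 * q k * q' k - oracleCoeff q k * oracleCoeff q' k) +
      μ * (oracleCoeff q k * oracleCoeff q' k) := by rw [hε]; ring
  have hcc : 0 ≤ oracleCoeff q k * oracleCoeff q' k := mul_nonneg (hcoeff _ _) (hcoeff _ _)
  have hε₀ : 0 ≤ ε := by rw [hε_eq]; positivity
  have hε₁ : ε ≤ (q k - q' k) ^ 2 / η + μ := by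
    rw [hε_eq]
    exact add_le_add b2 (mul_le_of_le_one_right hμ₀ b3)
  have hκ₁ : 2 * η * μ ≤ κ := by
    rw [hκ]
    calc 2 * η * μ = μ * (2 * η) := by ring
      _ ≤ (1 - (1 - μ) ^ 2) * oracleCoeff q' k ^ 2 := by
        refine mul_le_mul ?_ b4 (by positivity) ?_ <;> nlinarith
  have key := sq_mul_le_of_overlap_loss (U := U) A.gate_conjTranspose_mul (minusProj_posSemidef k)
    A.init_posSemidef A.init_trace hε₀ ((by positivity : 0 ≤ 2 * η * μ).trans hκ₁) hγ hKL hLL hT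
  have hw : ∑ t ∈ Finset.range A.queries,
      (minusProj W k * (U t * evolve U K K A.init t * (U t)ᴴ)).trace.re = A.armWeight q k := by
    simp only [QuantumAlgorithm.armWeight, A.state_eq_evolve hv]
    rfl
  rw [hw] at key
  have hw₀ := A.armWeight_nonneg hv k
  calc _ ≤ (1 - 2 * √(δ * (1 - δ))) ^ 2 * κ := by gcongr
    _ ≤ ε ^ 2 * A.armWeight q k := key
    _ ≤ _ := by gcongr

namespace IsRewardSequence

variable {N : ℕ} {η : ℝ} {p : ℕ → ℝ}

theorem le_of_le (hp : IsRewardSequence N η p) {i j : ℕ} (hi : 2 ≤ i) (hij : i ≤ j) (hj : j ≤ N) :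
    p j ≤ p i := by
  induction j, hij using Nat.le_induction with
  | base => exact le_rfl
  | succ j hij ih => exact (hp.antitone j (by omega) (by omega)).trans (ih (by omega))

theorem lt_one (hp : IsRewardSequence N η p) {i : ℕ} (hi : 2 ≤ i) (hiN : i ≤ N) : p i < p 1 :=
  (hp.le_of_le le_rfl hi hiN).trans_lt hp.two_lt_one

theorem lt_zero (hp : IsRewardSequence N η p) {i : ℕ} (hi : 1 ≤ i) (hiN : i ≤ N) : p i < p 0 := by
  rcases hi.eq_or_lt with rfl | hi
  · exact hp.one_lt_zero
  · exact (hp.lt_one hi hiN).trans hp.one_lt_zero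

theorem rewardVector_mem (hp : IsRewardSequence N η p) (k : ℕ) (j : Fin N) :
    rewardVector p k j ∈ Set.Icc η (1 - η) := by
  rw [rewardVector]
  split_ifs
  exacts [hp.mem_Icc 0 (by omega), hp.mem_Icc _ (by omega)]

theorem sum_fin_eq_sum_Icc (f : ℕ → ℝ) :
    ∑ j ∈ Finset.univ.filter (fun j : Fin N => 1 ≤ (j : ℕ)), f ((j : ℕ) + 1) = ∑ i ∈ Finset.Icc 2 N, f i := by
  refine Finset.sum_bij (fun j _ => (j : ℕ) + 1) ?_ ?_ ?_ ?_
  · intro j hj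
    simp only [Finset.mem_filter, Finset.mem_univ, true_and] at hj
    simp only [Finset.mem_Icc]
    omega
  · intro i _ j _ h
    ext
    omega
  · intro i hi
    simp only [Finset.mem_Icc] at hi
    exact ⟨⟨i - 1, by omega⟩, by simp; omega, by simp; omega⟩
  · intro j _
    rfl

theorem hardness_eq (hp : IsRewardSequence N η p) :
    hardness (rewardVector p 1 : Fin N → ℝ) = ∑ i ∈ Finset.Icc 2 N, 1 / (p 0 - p i) ^ 2 := by
  have hN := hp.two_le
  let z : Fin N := ⟨0, by omega⟩
  have : Nonempty (Fin N) := ⟨z⟩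
  have hval : ∀ j : Fin N, 1 ≤ (j : ℕ) → (rewardVector p 1 : Fin N → ℝ) j = p (j + 1) :=
    fun j hj => if_neg (by omega)
  have hz : ∀ j : Fin N, ¬ 1 ≤ (j : ℕ) → (rewardVector p 1 : Fin N → ℝ) j = p 0 :=
    fun j hj => if_pos (by omega)
  have hsup : ⨆ j, (rewardVector p 1 : Fin N → ℝ) j = p 0 := by
    refine le_antisymm (ciSup_le fun j => ?_) ?_
    · by_cases hj : 1 ≤ (j : ℕ)
      · rw [hval j hj]
        exact (hp.lt_zero (by omega) (by omega)).le
      · exact (hz j hj).le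
    · rw [← hz z (by simp [z])]
      exact le_ciSup (Finite.bddAbove_range _) z
  rw [hardness, hsup, ← sum_fin_eq_sum_Icc fun i => 1 / (p 0 - p i) ^ 2]
  refine Finset.sum_congr ?_ ?_
  · ext j
    simp only [Finset.mem_filter, Finset.mem_univ, true_and]
    by_cases hj : 1 ≤ (j : ℕ)
    · simp only [hj, iff_true, hval j hj]
      exact hp.lt_zero (by omega) (by omega)
    · simp [hz j hj]
      omega
  · intro j hj
    simp only [Finset.mem_filter, Finset.mem_univ, true_and] at hj
    rw [hval j hj]

theorem eq_of_isBestArm_zero (hp : IsRewardSequence N η p) {i : Fin N}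
    (hi : IsBestArm (rewardVector p 0) i) : (i : ℕ) = 0 := by
  by_contra h
  have hN := hp.two_le
  have h1 := hi ⟨0, by omega⟩ (by intro h'; simp [← h'] at h)
  simp only [rewardVector, Nat.add_eq_zero_iff, one_ne_zero, and_false, if_false, zero_add] at h1
  exact h1.not_gt (hp.lt_one (by omega) (by omega))

theorem eq_of_isBestArm_succ (hp : IsRewardSequence N η p) {i k : Fin N}
    (hi : IsBestArm (rewardVector p (k + 1)) i) : i = k := by
  by_contra h
  have h1 := hi k (Ne.symm h)
  have h2 : (i : ℕ) ≠ k := fun h' => h (Fin.ext h')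
  simp only [rewardVector, add_left_inj, h2, if_true, if_false] at h1
  exact h1.not_gt (hp.lt_zero (by omega) (by omega))

/-- If the weight bound for the single arms implies a lower bound `C / (p 0 - p i) ^ 2` of the
query weight of each arm, then `C` times the hardness is a lower bound of the number of queries. -/
theorem mul_hardness_le (hp : IsRewardSequence N η p) {δ C : ℝ} (hη : 0 < η) (hδ₀ : 0 ≤ δ)
    (hδ : δ ≤ 1 / 2) (hγ : 0 ≤ 1 - 2 * √(δ * (1 - δ)))
    (hC : ∀ i, 2 ≤ i → i ≤ N → ∃ μ : ℝ, 0 ≤ μ ∧ μ ≤ 1 ∧ ∀ w : ℝ,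
      (1 - 2 * √(δ * (1 - δ))) ^ 2 * (2 * η * μ) ≤ ((p 0 - p i) ^ 2 / η + μ) ^ 2 * w →
        C * (1 / (p 0 - p i) ^ 2) ≤ w)
    {W : Type} [Fintype W] [DecidableEq W] (A : QuantumAlgorithm N W)
    (hA : ∀ k, k ≤ N → A.IdentifiesBestArm δ (rewardVector p k)) :
    C * hardness (rewardVector p 1 : Fin N → ℝ) ≤ (A.queries : ℝ) := by
  have hmem k := hp.rewardVector_mem k
  have hv : ∀ k (j : Fin N), 0 ≤ rewardVector p k j * (1 - rewardVector p k j) :=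
    fun k j => mul_nonneg (hη.le.trans (hmem k j).1) (by linarith [(hmem k j).2])
  obtain ⟨b, hb, hbδ⟩ := hA 0 (by omega)
  have hb0 := hp.eq_of_isBestArm_zero hb
  rw [hp.hardness_eq, ← sum_fin_eq_sum_Icc fun i => 1 / (p 0 - p i) ^ 2, Finset.mul_sum]
  refine le_trans ?_ (A.sum_armWeight_le (hv 0))
  refine (Finset.sum_le_sum fun k hk => ?_).trans
    (Finset.sum_le_sum_of_subset_of_nonneg (Finset.filter_subset _ _)
      fun k _ _ => A.armWeight_nonneg (hv 0) k)
  simp only [Finset.mem_filter, Finset.mem_univ, true_and] at hk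
  obtain ⟨μ, hμ₀, hμ, hw⟩ := hC (k + 1) (by omega) (by omega)
  apply hw
  obtain ⟨i, hi, hiδ⟩ := hA (k + 1) (by omega)
  obtain rfl := hp.eq_of_isBestArm_succ hi
  have hbi : b ≠ i := fun h => by rw [h] at hb0; omega
  have key := A.armWeight_lower_bound (k := i) hη hδ₀ hδ hμ₀ hμ (hmem 0) (hmem (i + 1))
    (fun j hj => ?_) hbδ (A.outputProb_le_of_ne (hv _) hbi hiδ) hγ
  · have h1 : (rewardVector p 0 : Fin N → ℝ) i = p (i + 1) := by simp [rewardVector]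
    have h2 : (rewardVector p (i + 1) : Fin N → ℝ) i = p 0 := by simp [rewardVector]
    rwa [h1, h2, sub_sq_comm (p _)] at key
  · have : (j : ℕ) ≠ i := fun h => hj (Fin.ext h)
    simp [rewardVector, this]

end IsRewardSequence

theorem one_sub_two_mul_sqrt_pos {δ : ℝ} (hδ : δ < 1 / 2) :
    0 < 1 - 2 * √(δ * (1 - δ)) := by
  have : √(δ * (1 - δ)) < 1 / 2 := by
    rw [Real.sqrt_lt' (by norm_num)]
    nlinarith [mul_pos (sub_pos.mpr hδ) (sub_pos.mpr hδ)]
  linarith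

theorem mainTheorem1 (δ η : ℝ) (hδ₀ : 0 ≤ δ) (hδ : δ < 1 / 2) (hη : 0 < η) :
    (∃ c : ℝ, 0 < c ∧
      ∀ (N : ℕ) (p : ℕ → ℝ), IsRewardSequence N η p →
        hardness (rewardVector p 1 : Fin N → ℝ) = ∑ i ∈ Finset.Icc 2 N, 1 / (p 0 - p i) ^ 2 ∧
        ∀ (W : Type) [Fintype W] [DecidableEq W] (A : QuantumAlgorithm N W),
          (∀ k, k ≤ N → A.IdentifiesBestArm δ (rewardVector p k)) →
          c * hardness (rewardVector p 1 : Fin N → ℝ) ≤ (A.queries : ℝ)) ∧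
    (∀ (N : ℕ) (p : ℕ → ℝ), IsRewardSequence N η p → (p 0 - p N) ^ 2 / η ≤ 1 / 2 →
        ∀ (W : Type) [Fintype W] [DecidableEq W] (A : QuantumAlgorithm N W),
          (∀ k, k ≤ N → A.IdentifiesBestArm δ (rewardVector p k)) →
          (η * (1 - 2 * √(δ * (1 - δ))) / 20) ^ 2 * hardness (rewardVector p 1 : Fin N → ℝ)
            ≤ (A.queries : ℝ)) := by
  have hγ := one_sub_two_mul_sqrt_pos hδ
  set γ := 1 - 2 * √(δ * (1 - δ)) with hγ_def
  refine ⟨⟨2 * η * γ ^ 2 / (1 / η + 1) ^ 2, by positivity, fun N p hp =>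
    ⟨hp.hardness_eq, fun W _ _ A hA => ?_⟩⟩, fun N p hp hΔ W _ _ A hA => ?_⟩
  · refine hp.mul_hardness_le hη hδ₀ hδ.le hγ.le (fun i hi hiN => ?_) A hA
    have hpos : 0 < p 0 - p i := sub_pos.mpr (hp.lt_zero (by omega) hiN)
    have h0 := (hp.mem_Icc 0 (by omega)).2
    have h1 := (hp.mem_Icc i hiN).1
    refine ⟨(p 0 - p i) ^ 2, by positivity, pow_le_one₀ hpos.le (by linarith), fun w hw => ?_⟩
    rw [← hγ_def] at hw
    rw [div_mul_div_comm, div_le_iff₀ (by positivity)]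
    refine le_of_mul_le_mul_right (a := (p 0 - p i) ^ 2) ?_ (by positivity)
    calc _ = γ ^ 2 * (2 * η * (p 0 - p i) ^ 2) := by ring
      _ ≤ _ := hw
      _ = _ := by ring
  · refine hp.mul_hardness_le hη hδ₀ hδ.le hγ.le (fun i hi hiN => ?_) A hA
    have hpos : 0 < p 0 - p i := sub_pos.mpr (hp.lt_zero (by omega) hiN)
    have hle : (p 0 - p i) ^ 2 / η ≤ (p 0 - p N) ^ 2 / η := by
      gcongr
      exact hp.le_of_le hi hiN le_rfl
    refine ⟨(p 0 - p i) ^ 2 / η, by positivity, by linarith, fun w hw => ?_⟩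
    rw [← hγ_def] at hw
    set Δ := p 0 - p i
    rw [mul_one_div, div_le_iff₀ (by positivity)]
    have h2 : γ ^ 2 * η ^ 2 ≤ 2 * (w * Δ ^ 2) := by
      refine le_of_mul_le_mul_right (a := 2 * Δ ^ 2 / η ^ 2) ?_ (by positivity)
      calc _ = γ ^ 2 * (2 * η * (Δ ^ 2 / η)) := by field_simp
        _ ≤ _ := hw
        _ = _ := by field_simp; ring
    nlinarith [mul_pos (pow_pos hγ 2) (pow_pos hη 2)]
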